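/- Let $d$ be an odd prime and $\omega=e^{2\pi i/d}$. For one qudit ($\mathbb{C}^d$ with basis $|j\rangle$, $j\in\mathbb{Z}_d$) put $X|j\rangle=|j+1\rangle$, $Z|j\rangle=\omega^j|j\rangle$ and $T_{(a_1,a_2)}=\omega^{-a_1a_2/2}Z^{a_1}X^{a_2}$ for $(a_1,a_2)\in\mathbb{Z}_d^2$, where $1/2$ is the inverse of $2$ in $\mathbb{Z}_d$; for $n$ qudits and $u=(u_1,\dots,u_n)\in(\mathbb{Z}_d\times\mathbb{Z}_d)^n$ put $T_u=T_{u_1}\otimes\cdots\otimes T_{u_n}$. A unitary $U$ is Clifford if for every $u$ there are $\varphi\in\mathbb{R}$ and $u'$ with $UT_uU^\dagger=e^{i\varphi}T_{u'}$. The stabilizer states are the convex combinations of the states $U|0\rangle\langle 0|U^\dagger$ with $U$ Clifford. Let $$A_0=\frac1{d^n}\sum_u T_u,\qquad A_u=T_uA_0T_u^\dagger,\qquad W_\rho(u)=\frac1{d^n}\mathrm{Tr}(A_u\rho),$$ $$\|\rho\|_W=\sum_u|W_\rho(u)|,\qquad \mathrm{sn}(\rho)=\sum_{u:\,W_\rho(u)<0}|W_\rho(u)|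 .$$ A stabilizer protocol is a map from states of $n$ qudits to finite ensembles $\{(p_x,\sigma_x)\}$ of states of $m$ qudits (state $\sigma_x$ with probability $p_x$) that is composed from the following operations: conjugation by a Clifford unitary; composition $\rho\mapsto\rho\otimes\sigma$ with a stabilizer state $\sigma$; computational basis measurement of the final qudit; partial trace over the final qudit; and these operations conditioned on the outcomes of measurements or on classical randomness, where classical information may also be forgotten (which mixes the corresponding states). A real function $\mathcal{M}$ of the states of any number of qudits is a magic monotone if $\sum_x p_x\mathcal{M}(\sigma_x)\le\mathcal{M}(\rho)$ for every state $\rho$ and every stabilizer protocol, where the protocol turns $\rho$ into $\sigma_x$ with probability $p_x$. **Theorem.** The Wigner 1-norm $\|\cdot\|_W$ is a convex magic monotone. In particular, for all states of any number of qudits: 1. $\|p\rho+(1-p)\sigma\|_W\le p\|\rho\|_W+(1-p)\|\sigma\|_W$ for $0\le p\le1$; 2. $\|U\rho U^\dagger\|_W=\|\rho\|_W$ for every Clifford unitary $U$; 3. $\|\rho\otimes\sigma\|_W=\|\rho\|_W$ for every stabilizer state $\sigma$; 4. $\|\mathrm{Tr}_{\mathrm{last}}\,\rho\|_W\le\|\rho\|_W$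 for the partial trace over the final qudit; 5. $\sum_c p_c\,\|\rho_c\|_W\le\|\rho\|_W$, where, with $P_c=\mathbb{I}\otimes|c\rangle\langle c|$, $p_c=\mathrm{Tr}(\rho P_c)$ is the probability of the outcome $c$ of the computational basis measurement of the final qudit and $\rho_c=P_c\rho P_c/p_c$ is the state after it (outcomes with $p_c=0$ contribute $0$). Consequently the sum negativity, for which $\mathrm{sn}(\rho)=\frac12(\|\rho\|_W-1)$, is a magic monotone. -/

import Mathlib

open scoped ComplexOrder

namespace Qudit

/-- Operators on `n` qudits of dimension `d`, as matrices in the computational basis, whose labels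
are the strings `Fin n → ZMod d`. -/
abbrev Op (d n : ℕ) : Type := Matrix (Fin n → ZMod d) (Fin n → ZMod d) ℂ

/-- The phase space `(ℤ_d × ℤ_d)^n` of `n` qudits. -/
abbrev PhaseSpace (d n : ℕ) : Type := Fin n → ZMod d × ZMod d

/-- Density operators: positive semidefinite with trace one. -/
def IsState {d n : ℕ} [NeZero d] (ρ : Op d n) : Prop :=
  ρ.PosSemidef ∧ ρ.trace = 1

/-! ### Heisenberg-Weyl operators, Clifford unitaries, stabilizer states -/

/-- The shift operator `X|j⟩ = |j + 1⟩` of one qudit. -/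
def shiftX (d : ℕ) : Matrix (ZMod d) (ZMod d) ℂ :=
  fun i j => if i = j + 1 then 1 else 0

/-- The boost operator `Z|j⟩ = ω^j |j⟩` of one qudit; `ZMod.stdAddChar j` is `ω^j` with
`ω = exp(2πi/d)`. -/
noncomputable def boostZ (d : ℕ) [NeZero d] : Matrix (ZMod d) (ZMod d) ℂ :=
  Matrix.diagonal fun j => ZMod.stdAddChar j

/-- The Heisenberg-Weyl operator `T_(a₁,a₂) = ω^(-a₁a₂/2) Z^a₁ X^a₂` of one qudit of odd
dimension `d`; the division by two is that of `ZMod d`. -/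
noncomputable def weyl₁ (d : ℕ) [NeZero d] (a : ZMod d × ZMod d) :
    Matrix (ZMod d) (ZMod d) ℂ :=
  ZMod.stdAddChar (-(a.1 * a.2 * 2⁻¹)) • (boostZ d ^ a.1.val * shiftX d ^ a.2.val)

/-- The Heisenberg-Weyl operator `T_u = T_(u 0) ⊗ ⋯ ⊗ T_(u (n-1))` of `n` qudits. -/
noncomputable def weyl {d n : ℕ} [NeZero d] (u : PhaseSpace d n) : Op d n :=
  fun i j => ∏ k, weyl₁ d (u k) (i k) (j k)

/-- Clifford unitaries: those that map Heisenberg-Weyl operators to Heisenberg-Weyl operators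
up to a phase. -/
def IsClifford {d n : ℕ} [NeZero d] (U : Op d n) : Prop :=
  U ∈ Matrix.unitaryGroup (Fin n → ZMod d) ℂ ∧
    ∀ u : PhaseSpace d n, ∃ (φ : ℝ) (u' : PhaseSpace d n),
      U * weyl u * U.conjTranspose = Complex.exp (φ * Complex.I) • weyl u'

/-- The pure stabilizer states `U|0⟩⟨0|U†`, with `U` a Clifford unitary. -/
def pureStabilizerStates (d n : ℕ) [NeZero d] : Set (Op d n) :=
  {S | ∃ U : Op d n, IsClifford U ∧ S = U * Matrix.single 0 0 1 * U.conjTranspose}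

/-- The stabilizer states: the convex hull of the pure stabilizer states. -/
def stabilizerStates (d n : ℕ) [NeZero d] : Set (Op d n) :=
  convexHull ℝ (pureStabilizerStates d n)

/-! ### Elementary operations -/

/-- `ρ ⊗ σ`, where the qudits of `σ` are put after those of `ρ`. -/
def tensor {d n k : ℕ} (ρ : Op d n) (σ : Op d k) : Op d (n + k) :=
  fun i j => ρ (fun a => i (Fin.castAdd k a)) (fun a => j (Fin.castAdd k a)) *
    σ (fun b => i (Fin.natAdd n b)) (fun b => j (Fin.natAdd n b))

/-- The partial trace over the final qudit. -/
def partialTrace {d n : ℕ} [NeZero d] (ρ : Op d (n + 1)) : Op d n :=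
  fun i j => ∑ c : ZMod d,
    ρ (Fin.snoc (α := fun _ => ZMod d) i c) (Fin.snoc (α := fun _ => ZMod d) j c)

/-- The projector `𝟙 ⊗ |c⟩⟨c|` onto the value `c` of the final qudit. -/
def lastProj {d : ℕ} (n : ℕ) (c : ZMod d) : Op d (n + 1) :=
  Matrix.diagonal fun i => if i (Fin.last n) = c then 1 else 0

/-- The probability `Tr(ρ (𝟙 ⊗ |c⟩⟨c|))` of the outcome `c` of the computational basis measurement
of the final qudit. -/
noncomputable def measProb {d n : ℕ} [NeZero d] (ρ : Op d (n + 1)) (c : ZMod d) : ℝ :=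
  (ρ * lastProj n c).trace.re

/-- The state after the outcome `c` of the computational basis measurement of the final qudit
(meaningful if the outcome has non-zero probability). -/
noncomputable def measState {d n : ℕ} [NeZero d] (ρ : Op d (n + 1)) (c : ZMod d) : Op d (n + 1) :=
  (measProb ρ c)⁻¹ • (lastProj n c * ρ * lastProj n c)

/-! ### Stabilizer protocols and magic monotones -/

/-- Stabilizer protocols from `n` to `m` qudits. A protocol `Λ` ends with a classical outcome `x`
in a finite set `ι`; it is described by the subnormalised operators `Λ ρ x`: on the input
state `ρ`, the outcome `x` has probability `Tr (Λ ρ x)`, and the output state is then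
`Λ ρ x / Tr (Λ ρ x)`.

`cond` performs a further protocol that depends on the outcome so far (and remembers both
outcomes); `coarse` replaces the outcome `x` by `f x`, so that states with the same `f x` are mixed;
with `κ` a one-point type, all classical information is forgotten. -/
inductive IsStabilizerProtocol (d : ℕ) [NeZero d] :
    ∀ {n m : ℕ} {ι : Type} [Fintype ι], (Op d n → ι → Op d m) → Prop
  | clifford {n : ℕ} (U : Op d n) (hU : IsClifford U) :
      IsStabilizerProtocol d fun (ρ : Op d n) (_ : Unit) => U * ρ * U.conjTranspose
  | compose {n k : ℕ} (σ : Op d k) (hσ : σ ∈ stabilizerStates d k) :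
      IsStabilizerProtocol d fun (ρ : Op d n) (_ : Unit) => tensor ρ σ
  | measure {n : ℕ} :
      IsStabilizerProtocol d fun (ρ : Op d (n + 1)) (c : ZMod d) =>
        lastProj n c * ρ * lastProj n c
  | trace {n : ℕ} :
      IsStabilizerProtocol d fun (ρ : Op d (n + 1)) (_ : Unit) => partialTrace ρ
  | random {n : ℕ} {ι : Type} [Fintype ι] (p : ι → ℝ) (hp : ∀ x, 0 ≤ p x) (hp1 : ∑ x, p x = 1) :
      IsStabilizerProtocol d fun (ρ : Op d n) (x : ι) => p x • ρ
  | cond {n k m : ℕ} {ι κ : Type} [Fintype ι] [Fintype κ]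
      (Λ : Op d n → ι → Op d k) (Γ : ι → Op d k → κ → Op d m)
      (hΛ : IsStabilizerProtocol d Λ) (hΓ : ∀ x, IsStabilizerProtocol d (Γ x)) :
      IsStabilizerProtocol d fun (ρ : Op d n) (xy : ι × κ) => Γ xy.1 (Λ ρ xy.1) xy.2
  | coarse {n m : ℕ} {ι κ : Type} [Fintype ι] [Fintype κ] [DecidableEq κ]
      (Λ : Op d n → ι → Op d m) (f : ι → κ) (hΛ : IsStabilizerProtocol d Λ) :
      IsStabilizerProtocol d fun (ρ : Op d n) (y : κ) => ∑ x with f x = y, Λ ρ x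

/-- A function `M` of the states of any number of qudits is a magic monotone if it does not increase
on average under stabilizer protocols: if the protocol turns `ρ` into `σ_x` with probability `p_x`,
then `∑ x, p_x M(σ_x) ≤ M(ρ)`. Only the values of `M` at states matter: an outcome of probability
zero contributes zero. -/
def IsMagicMonotone (d : ℕ) [NeZero d] (M : ∀ n : ℕ, Op d n → ℝ) : Prop :=
  ∀ (n m : ℕ) (ι : Type) [Fintype ι] (Λ : Op d n → ι → Op d m), IsStabilizerProtocol d Λ →
    ∀ ρ : Op d n, IsState ρ →
      ∑ x, (Λ ρ x).trace.re * M m ((Λ ρ x).trace.re⁻¹ • Λ ρ x) ≤ M n ρ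

/-! ### The discrete Wigner function -/

/-- The phase space point operator `A_0 = d^(-n) ∑ u, T_u`. -/
noncomputable def phasePoint₀ (d n : ℕ) [NeZero d] : Op d n :=
  ((d : ℂ) ^ n)⁻¹ • ∑ u : PhaseSpace d n, weyl u

/-- The phase space point operators `A_u = T_u A_0 T_u†`. -/
noncomputable def phasePoint {d n : ℕ} [NeZero d] (u : PhaseSpace d n) : Op d n :=
  weyl u * phasePoint₀ d n * (weyl u).conjTranspose

theorem boostZ_pow_mul_shiftX_pow (d : ℕ) [NeZero d] (a b : ZMod d) (i j : ZMod d) :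
    (boostZ d ^ a.val * shiftX d ^ b.val) i j =
      if i = j + b then ZMod.stdAddChar (a * i) else 0 := by
  have hX : ∀ (m : ℕ) (i j : ZMod d), (shiftX d ^ m) i j = if i = j + m then 1 else 0 := by
    intro m
    induction m with
    | zero => intro i j; simp [Matrix.one_apply]
    | succ m ih =>
      intro i j
      rw [pow_succ, Matrix.mul_apply]
      simp only [ih, shiftX]
      simp [add_assoc, add_comm (1 : ZMod d)]
  rw [boostZ, Matrix.diagonal_pow, Matrix.diagonal_mul, hX]
  simp only [Pi.pow_apply, ← AddChar.map_nsmul_eq_pow, nsmul_eq_mul, ZMod.natCast_zmod_val]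
  split_ifs <;> simp

/-- `T_u† = T_(-u)` in odd dimension. -/
theorem weyl_conjTranspose {d n : ℕ} [NeZero d] (hd : Odd d) (u : PhaseSpace d n) :
    (weyl u).conjTranspose = weyl (-u) := by
  have h2 : (2 : ZMod d) * 2⁻¹ = 1 := by
    have := ZMod.coe_mul_inv_eq_one (n := d) 2 (Nat.coprime_two_left.mpr hd)
    simpa using this
  ext i j
  simp only [weyl, Matrix.conjTranspose_apply, star_prod, weyl₁, Matrix.smul_apply, smul_eq_mul,
    boostZ_pow_mul_shiftX_pow, star_mul', Pi.neg_apply, Prod.fst_neg, Prod.snd_neg]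
  refine Finset.prod_congr rfl fun k _ => ?_
  have hs : ∀ x : ZMod d, star (ZMod.stdAddChar x : ℂ) = ZMod.stdAddChar (-x) := by
    intro x
    rw [AddChar.map_neg_eq_conj]
    rfl
  by_cases h : j k = i k + (u k).2
  · rw [if_pos h, if_pos (by rw [h]; ring), hs, hs, ← AddChar.map_add_eq_mul,
      ← AddChar.map_add_eq_mul, h]
    congr 1
    linear_combination ((u k).1 * (u k).2) * h2
  · rw [if_neg h, if_neg (fun h' => h (by rw [h']; ring))]
    simp

/-- The phase space point operators are Hermitian. -/
theorem phasePoint_isHermitian {d n : ℕ} [NeZero d] (hd : Odd d) (u : PhaseSpace d n) :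
    (phasePoint u).IsHermitian := by
  have h0 : (phasePoint₀ d n).conjTranspose = phasePoint₀ d n := by
    rw [phasePoint₀, Matrix.conjTranspose_smul, Matrix.conjTranspose_sum]
    congr 1
    · simp
    · simp only [weyl_conjTranspose hd]
      exact Fintype.sum_equiv (Equiv.neg _) _ _ fun _ => rfl
  rw [Matrix.IsHermitian, phasePoint, Matrix.conjTranspose_mul, Matrix.conjTranspose_mul, h0,
    Matrix.conjTranspose_conjTranspose, Matrix.mul_assoc]

/-- The discrete Wigner function `W_ρ(u) = d^(-n) Tr(A_u ρ)`. It takes real values at Hermitian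
operators, see `wigner_im`. -/
noncomputable def wigner {d n : ℕ} [NeZero d] (ρ : Op d n) (u : PhaseSpace d n) : ℂ :=
  ((d : ℂ) ^ n)⁻¹ * (phasePoint u * ρ).trace

/-- The Wigner function of a Hermitian operator is real-valued. -/
theorem wigner_im {d n : ℕ} [NeZero d] (hd : Odd d) {ρ : Op d n} (hρ : ρ.IsHermitian)
    (u : PhaseSpace d n) : (wigner ρ u).im = 0 := by
  rw [← Complex.conj_eq_iff_im]
  have h : star (phasePoint u * ρ).trace = (phasePoint u * ρ).trace := by
    rw [← Matrix.trace_conjTranspose, Matrix.conjTranspose_mul, hρ.eq,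
      (phasePoint_isHermitian hd u).eq, Matrix.trace_mul_comm]
  rw [wigner, map_mul]
  congr 1
  simp

/-- The Wigner 1-norm `∑ u, |W_ρ(u)|`. -/
noncomputable def wignerNorm {d : ℕ} [NeZero d] (n : ℕ) (ρ : Op d n) : ℝ :=
  ∑ u : PhaseSpace d n, ‖wigner ρ u‖

/-- The sum negativity `sn(ρ)`: the sum of `|W_ρ(u)|` over the `u` with `W_ρ(u) < 0`. -/
noncomputable def sumNegativity {d : ℕ} [NeZero d] (n : ℕ) (ρ : Op d n) : ℝ :=
  ∑ u : PhaseSpace d n with (wigner ρ u).re < 0, ‖wigner ρ u‖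

end Qudit

/-! The Wigner function is linear in `ρ`, so its 1-norm is a seminorm; convexity and the
harmlessness of forgetting outcomes are triangle inequalities. Everything else rests on three
properties of the operators `A_u`.

Cliffords permute them. If `U T_u U† = c(u) T_(S u)`, the commutation relations force `S` to
preserve the symplectic form `[·,·]`, and the product law then forces `c` to be a character, so
`c(u) = ω^[a,u]`. Since `A_w` is the symplectic Fourier transform of the `T_u`, it is sent to
`A_(S(w+a))` (`IsClifford.exists_perm`).

They factorise over qudits, so the norm is multiplicative under tensor products. The state `|0⟩⟨0|`
has a nonnegative Wigner function of sum 1, and Clifford invariance and convexity give every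
stabilizer state norm 1.

On one qudit `∑_a A_(a,b) = d |b⟩⟨b|`. Hence marginals of `W_ρ` are Wigner functions of the diagonal
blocks of `ρ` with respect to the final qudit, which bounds both measurement and partial trace
(`sum_wignerNorm_lastBlock_le`).

Induction over protocols gives `∑ x, ‖Λ ρ x‖_W ≤ ‖ρ‖_W` for the subnormalised outputs, and
homogeneity restores the probabilities. On Hermitian operators the sum negativity is half of norm
minus trace, and protocols preserve the total trace. -/

namespace Qudit

open Matrix

/-! ### Product operators -/

/-- The tensor product of a family of one-qudit operators. -/
def prodOp {d n : ℕ} (A : Fin n → Matrix (ZMod d) (ZMod d) ℂ) : Op d n :=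
  fun i j => ∏ k, A k (i k) (j k)

section

variable {d n : ℕ}

theorem sum_prod_apply {ι : Type*} [Fintype ι] (f : Fin n → ι → ℂ) :
    ∑ x : Fin n → ι, ∏ k, f k (x k) = ∏ k, ∑ y, f k y := by
  classical
  rw [Finset.prod_univ_sum, Fintype.piFinset_univ]

theorem sum_prodOp {ι : Type*} [Fintype ι] (A : ι → Matrix (ZMod d) (ZMod d) ℂ) :
    ∑ u : Fin n → ι, prodOp (fun k => A (u k)) = prodOp fun _ => ∑ a, A a := by
  ext i j
  simp only [Matrix.sum_apply, prodOp]
  exact sum_prod_apply fun k a => A a (i k) (j k)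

theorem prodOp_smul (c : Fin n → ℂ) (A : Fin n → Matrix (ZMod d) (ZMod d) ℂ) :
    prodOp (fun k => c k • A k) = (∏ k, c k) • prodOp A := by
  ext i j
  simp [prodOp, Finset.prod_mul_distrib]

/-! ### The symplectic form -/

/-- The symplectic form of the phase space. -/
def symplForm (u v : PhaseSpace d n) : ZMod d :=
  ∑ k, ((u k).1 * (v k).2 - (v k).1 * (u k).2)

theorem symplForm_swap (u v : PhaseSpace d n) : symplForm v u = -symplForm u v := by
  simp only [symplForm, ← Finset.sum_neg_distrib]
  exact Finset.sum_congr rfl fun k _ => by ring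

theorem symplForm_add_right (u v w : PhaseSpace d n) :
    symplForm u (v + w) = symplForm u v + symplForm u w := by
  simp only [symplForm, ← Finset.sum_add_distrib, Pi.add_apply, Prod.fst_add, Prod.snd_add]
  exact Finset.sum_congr rfl fun k _ => by ring

theorem symplForm_add_left (u v w : PhaseSpace d n) :
    symplForm (u + v) w = symplForm u w + symplForm v w := by
  rw [symplForm_swap, symplForm_add_right, symplForm_swap u, symplForm_swap v]
  ring

theorem symplForm_self (u : PhaseSpace d n) : symplForm u u = 0 := by
  simp [symplForm]

/-- Nondegeneracy: pairing with the two unit vectors at position `k` reads off both coordinates of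
`u k`. -/
theorem eq_of_symplForm {u v : PhaseSpace d n} (h : ∀ w, symplForm u w = symplForm v w) :
    u = v := by
  funext k
  have key : ∀ (u : PhaseSpace d n) (x : ZMod d × ZMod d),
      symplForm u (Pi.single k x) = (u k).1 * x.2 - x.1 * (u k).2 := by
    intro u x
    rw [symplForm, Finset.sum_eq_single k]
    · simp
    · intro b _ hb
      simp [hb]
    · simp
  have h1 := h (Pi.single k (0, 1))
  have h2 := h (Pi.single k (1, 0))
  rw [key, key] at h1 h2
  ext
  · simpa using h1
  · simpa using h2

theorem two_mul_inv_two (hd : Odd d) : (2 : ZMod d) * 2⁻¹ = 1 := by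
  have := ZMod.coe_mul_inv_eq_one (n := d) 2 (Nat.coprime_two_left.mpr hd)
  simpa using this

theorem two_mul_cancel (hd : Odd d) {x y : ZMod d} (h : 2 * x = 2 * y) : x = y := by
  have h2 := two_mul_inv_two hd
  linear_combination (2⁻¹ : ZMod d) * h + (y - x) * h2

variable [NeZero d]

theorem prodOp_mul (A B : Fin n → Matrix (ZMod d) (ZMod d) ℂ) :
    prodOp A * prodOp B = prodOp fun k => A k * B k := by
  ext i j
  simp only [mul_apply, prodOp, ← Finset.prod_mul_distrib]
  exact sum_prod_apply fun k y => A k (i k) y * B k y (j k)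

theorem weyl_eq_prodOp (u : PhaseSpace d n) : weyl u = prodOp fun k => weyl₁ d (u k) := rfl

/-! ### Products of Heisenberg-Weyl operators -/

theorem map_sum_eq_prod {A ι : Type*} [AddCommMonoid A] (ψ : AddChar A ℂ) (s : Finset ι)
    (f : ι → A) : ψ (∑ k ∈ s, f k) = ∏ k ∈ s, ψ (f k) := by
  classical
  induction s using Finset.induction_on with
  | empty => simp
  | insert a s ha ih =>
    rw [Finset.sum_insert ha, Finset.prod_insert ha, AddChar.map_add_eq_mul, ih]

theorem weyl₁_apply (a : ZMod d × ZMod d) (i j : ZMod d) :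
    weyl₁ d a i j =
      if i = j + a.2 then ZMod.stdAddChar (a.1 * (i - a.2 * 2⁻¹)) else 0 := by
  rw [weyl₁, Matrix.smul_apply, boostZ_pow_mul_shiftX_pow, smul_eq_mul]
  split_ifs
  · rw [← AddChar.map_add_eq_mul]
    congr 1
    ring
  · simp

/-- The prefactor `ω^(-a₁a₂/2)` is what makes the phase antisymmetric, namely half the symplectic
form. -/
theorem weyl₁_mul (hd : Odd d) (a b : ZMod d × ZMod d) :
    weyl₁ d a * weyl₁ d b =
      (ZMod.stdAddChar (2⁻¹ * (a.1 * b.2 - b.1 * a.2)) : ℂ) • weyl₁ d (a + b) := by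
  have h2 := two_mul_inv_two hd
  ext i j
  simp only [mul_apply, Matrix.smul_apply, smul_eq_mul, weyl₁_apply, mul_ite, mul_zero,
    Finset.sum_ite_eq', Finset.mem_univ, if_true, Prod.fst_add, Prod.snd_add]
  by_cases h : i = j + (a.2 + b.2)
  · rw [if_pos h, if_pos (by rw [h]; ring), ← AddChar.map_add_eq_mul, ← AddChar.map_add_eq_mul]
    congr 1
    rw [h]
    linear_combination (b.1 * a.2) * h2
  · rw [if_neg h, if_neg (fun h' => h (by rw [h']; ring)), zero_mul]

theorem weyl_mul (hd : Odd d) (u v : PhaseSpace d n) :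
    weyl u * weyl v = (ZMod.stdAddChar (2⁻¹ * symplForm u v) : ℂ) • weyl (u + v) := by
  simp only [weyl_eq_prodOp, prodOp_mul, weyl₁_mul hd, prodOp_smul]
  rw [symplForm, Finset.mul_sum, map_sum_eq_prod]
  rfl

theorem weyl_mul_comm (hd : Odd d) (u v : PhaseSpace d n) :
    weyl u * weyl v = (ZMod.stdAddChar (symplForm u v) : ℂ) • (weyl v * weyl u) := by
  have h2 := two_mul_inv_two hd
  rw [weyl_mul hd, weyl_mul hd, add_comm v u, smul_smul, ← AddChar.map_add_eq_mul,
    symplForm_swap u v]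
  congr 2
  linear_combination symplForm u v * h2

theorem weyl_zero : weyl (0 : PhaseSpace d n) = 1 := by
  ext i j
  simp only [weyl, Pi.zero_apply, weyl₁_apply, Prod.fst_zero, Prod.snd_zero, add_zero, zero_mul,
    AddChar.map_zero_eq_one, one_apply]
  by_cases h : i = j
  · simp [h]
  · obtain ⟨k, hk⟩ := Function.ne_iff.mp h
    rw [if_neg h]
    exact Finset.prod_eq_zero (Finset.mem_univ k) (if_neg hk)

theorem weyl_mul_neg (hd : Odd d) (u : PhaseSpace d n) : weyl u * weyl (-u) = 1 := by
  have h : symplForm u (-u) = 0 := by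
    have := symplForm_add_right u u (-u)
    rw [add_neg_cancel, symplForm_self, zero_add] at this
    rw [← this]
    simp [symplForm]
  rw [weyl_mul hd, h]
  simp [weyl_zero]

/-- Heisenberg-Weyl operators that are proportional have the same label. -/
theorem eq_of_weyl_eq_smul (hd : Odd d) {u v : PhaseSpace d n} {c : ℂ}
    (h : weyl u = c • weyl v) : u = v := by
  -- The phase picked up on commuting past `T_w` is unaffected by the scalar `c`, so it determines
  -- the label.
  have hs : ∀ w : PhaseSpace d n,
      (ZMod.stdAddChar (symplForm u w) : ℂ) • (weyl w * weyl u) =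
        (ZMod.stdAddChar (symplForm v w) : ℂ) • (weyl w * weyl u) := by
    intro w
    rw [← weyl_mul_comm hd, h, smul_mul_assoc, weyl_mul_comm hd, mul_smul_comm, smul_comm]
  refine eq_of_symplForm fun w => ZMod.injective_stdAddChar ?_
  have hne : weyl w * weyl u ≠ 0 := by
    intro h0
    have h1 : weyl (-w) * (weyl w * weyl u) * weyl (-u) = 1 := by
      have := weyl_mul_neg hd (-w)
      rw [neg_neg] at this
      rw [← mul_assoc, this, one_mul, weyl_mul_neg hd]
    rw [h0, mul_zero, zero_mul] at h1
    exact zero_ne_one h1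
  exact smul_left_injective ℂ hne (hs w)

/-! ### Phase space point operators -/

/-- The phase space point operators of one qudit. -/
noncomputable def phasePoint₁ (d : ℕ) [NeZero d] (a : ZMod d × ZMod d) :
    Matrix (ZMod d) (ZMod d) ℂ :=
  fun i j => if i + j = 2 * a.2 then ZMod.stdAddChar (a.1 * (i - j)) else 0

theorem sum_stdAddChar_mul (b : ZMod d) :
    ∑ x : ZMod d, (ZMod.stdAddChar (x * b) : ℂ) = if b = 0 then (d : ℂ) else 0 := by
  rw [AddChar.sum_mulShift b (ZMod.isPrimitive_stdAddChar d), ZMod.card]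
  push_cast
  rfl

/-- Only `a₂ = i - j` contributes, and the character sum over `a₁` vanishes unless `(i + j)/2 = 0`:
the sum is `d` times the parity operator. -/
theorem sum_weyl₁_apply (hd : Odd d) (i j : ZMod d) :
    (∑ a, weyl₁ d a) i j = if i = -j then (d : ℂ) else 0 := by
  have h2 := two_mul_inv_two hd
  simp only [Matrix.sum_apply, weyl₁_apply]
  rw [Fintype.sum_prod_type]
  have : ∀ x y : ZMod d, (i = j + y) ↔ (y = i - j) := fun x y =>
    ⟨fun h => by rw [h]; ring, fun h => by rw [h]; ring⟩
  simp only [this i, Finset.sum_ite_eq', Finset.mem_univ, if_true]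
  rw [sum_stdAddChar_mul]
  refine if_congr ⟨fun h => ?_, fun h => ?_⟩ rfl rfl
  · linear_combination 2 * h + (i - j) * h2
  · rw [h]
    linear_combination j * h2

/-- `A_0` is a tensor power of the parity operator; conjugation by `T_a` moves the centre of the
reflection from `0` to `a₂`, whence the condition `i + j = 2a₂`. -/
theorem phasePoint_eq_prodOp (hd : Odd d) (u : PhaseSpace d n) :
    phasePoint u = prodOp fun k => phasePoint₁ d (u k) := by
  have h2 := two_mul_inv_two hd
  have hd0 : (d : ℂ) ≠ 0 := NeZero.ne _
  have h0 : phasePoint₀ d n = prodOp fun _ => (d : ℂ)⁻¹ • ∑ a, weyl₁ d a := by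
    rw [prodOp_smul, phasePoint₀, ← sum_prodOp]
    simp [weyl_eq_prodOp]
  rw [phasePoint, weyl_conjTranspose hd, h0, weyl_eq_prodOp, weyl_eq_prodOp, prodOp_mul, prodOp_mul]
  congr 1
  funext k
  ext i j
  have hp : ∀ i j : ZMod d, ((d : ℂ)⁻¹ • ∑ a, weyl₁ d a) i j = if i = -j then 1 else 0 := by
    intro i j
    rw [Matrix.smul_apply, sum_weyl₁_apply hd, smul_eq_mul]
    split_ifs <;> simp [hd0]
  simp only [mul_apply, hp, mul_ite, mul_one, mul_zero, weyl₁_apply,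
    phasePoint₁, Pi.neg_apply, Prod.fst_neg, Prod.snd_neg]
  simp only [Finset.sum_ite_eq', Finset.mem_univ, if_true]
  by_cases h : i + j = 2 * (u k).2
  · rw [if_pos h, if_pos (by linear_combination h), ← AddChar.map_add_eq_mul]
    congr 1
    linear_combination (-((u k).1 * (u k).2)) * h2
  · rw [if_neg h, if_neg (fun h' => h (by linear_combination h')), zero_mul]

/-- Conjugation by `T_w` only multiplies each `T_u` in `A_0` by `ω^[w,u]`. -/
theorem phasePoint_eq_sum (hd : Odd d) (w : PhaseSpace d n) :
    phasePoint w =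
      ((d : ℂ) ^ n)⁻¹ • ∑ u, (ZMod.stdAddChar (symplForm w u) : ℂ) • weyl u := by
  rw [phasePoint, phasePoint₀, mul_smul_comm, smul_mul_assoc, Finset.mul_sum, Finset.sum_mul]
  congr 1
  refine Finset.sum_congr rfl fun u _ => ?_
  rw [weyl_mul_comm hd, smul_mul_assoc, mul_assoc, weyl_conjTranspose hd, weyl_mul_neg hd, mul_one]

/-! ### Clifford unitaries permute the phase space point operators -/

/-- By nondegeneracy `a ↦ ω^[a,·]` is injective into the dual group, which has the same cardinality
as the phase space. -/
theorem exists_symplForm_eq_addChar (ψ : AddChar (PhaseSpace d n) ℂ) :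
    ∃ a : PhaseSpace d n, ∀ u, ψ u = ZMod.stdAddChar (symplForm a u) := by
  let f : PhaseSpace d n → AddChar (PhaseSpace d n) ℂ := fun a =>
    { toFun := fun u => ZMod.stdAddChar (symplForm a u)
      map_zero_eq_one' := by simp [symplForm]
      map_add_eq_mul' := fun u v => by rw [symplForm_add_right, AddChar.map_add_eq_mul] }
  have hf : Function.Injective f := fun a b hab => eq_of_symplForm fun w =>
    ZMod.injective_stdAddChar (DFunLike.congr_fun hab w)
  obtain ⟨a, ha⟩ := ((Fintype.bijective_iff_injective_and_card f).mpr
    ⟨hf, AddChar.card_eq.symm⟩).2 ψ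
  exact ⟨a, fun u => by rw [← ha]; rfl⟩

theorem conj_mul_conj {U : Op d n} (hU : U ∈ unitaryGroup (Fin n → ZMod d) ℂ) (A B : Op d n) :
    U * A * Uᴴ * (U * B * Uᴴ) = U * (A * B) * Uᴴ := by
  have h : Uᴴ * U = 1 := mem_unitaryGroup_iff'.mp hU
  calc U * A * Uᴴ * (U * B * Uᴴ) = U * A * (Uᴴ * U) * B * Uᴴ := by simp only [mul_assoc]
    _ = U * (A * B) * Uᴴ := by rw [h, mul_one]; simp only [mul_assoc]

theorem trace_conj {U : Op d n} (hU : U ∈ unitaryGroup (Fin n → ZMod d) ℂ) (A : Op d n) :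
    (U * A * Uᴴ).trace = A.trace := by
  rw [trace_mul_comm, ← mul_assoc, show Uᴴ * U = 1 from mem_unitaryGroup_iff'.mp hU, one_mul]

theorem weyl_ne_zero (hd : Odd d) (u : PhaseSpace d n) : weyl u ≠ 0 := by
  intro h
  have := weyl_mul_neg hd u
  rw [h, zero_mul] at this
  exact zero_ne_one this

/-- A Clifford unitary acts on the Heisenberg-Weyl operators by a symplectic map of the phase
space and a character. -/
theorem IsClifford.exists_symplectic (hd : Odd d) {U : Op d n} (hU : IsClifford U) :
    ∃ (S : PhaseSpace d n → PhaseSpace d n) (a : PhaseSpace d n),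
      (∀ u v, symplForm (S u) (S v) = symplForm u v) ∧
      ∀ u, U * weyl u * Uᴴ = (ZMod.stdAddChar (symplForm a u) : ℂ) • weyl (S u) := by
  have h2 := two_mul_inv_two hd
  obtain ⟨hU, hC⟩ := hU
  choose φ S hS using hC
  set c : PhaseSpace d n → ℂ := fun u => Complex.exp (φ u * Complex.I) with hc
  have hc0 : ∀ u, c u ≠ 0 := fun u => Complex.exp_ne_zero _
  replace hS : ∀ u, U * weyl u * Uᴴ = c u • weyl (S u) := hS
  -- Conjugating the commutation relation by `U` puts the phases `c u * c v` on both sides, where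
  -- they cancel.
  have hsym : ∀ u v, symplForm (S u) (S v) = symplForm u v := by
    intro u v
    have h1 := congrArg (fun A => U * A * Uᴴ) (weyl_mul_comm hd u v)
    simp only [mul_smul_comm, smul_mul_assoc] at h1
    rw [← conj_mul_conj hU, ← conj_mul_conj hU, hS, hS] at h1
    simp only [mul_smul_comm, smul_mul_assoc] at h1
    rw [weyl_mul_comm hd (S u) (S v), weyl_mul hd (S v)] at h1
    simp only [smul_smul] at h1
    have h3 := smul_left_injective ℂ (weyl_ne_zero hd _) h1
    refine ZMod.injective_stdAddChar ?_
    have hx : (ZMod.stdAddChar (2⁻¹ * symplForm (S v) (S u)) : ℂ) ≠ 0 :=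
      (AddChar.val_isUnit _ _).ne_zero
    have h4 : c u * c v * (ZMod.stdAddChar (2⁻¹ * symplForm (S v) (S u)) : ℂ) ≠ 0 :=
      mul_ne_zero (mul_ne_zero (hc0 u) (hc0 v)) hx
    refine mul_right_cancel₀ h4 ?_
    linear_combination h3
  have hadd : ∀ u v, c (u + v) = c u * c v := by
    intro u v
    have h1 := congrArg (fun A => U * A * Uᴴ) (weyl_mul hd u v)
    simp only [mul_smul_comm, smul_mul_assoc] at h1
    rw [← conj_mul_conj hU, hS, hS, hS] at h1
    simp only [mul_smul_comm, smul_mul_assoc] at h1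
    rw [weyl_mul hd (S u) (S v), hsym] at h1
    simp only [smul_smul] at h1
    have hx : (ZMod.stdAddChar (2⁻¹ * symplForm u v) : ℂ) ≠ 0 :=
      (AddChar.val_isUnit _ _).ne_zero
    -- The conjugated product law makes `T_(S(u+v))` and `T_(S u + S v)` proportional, so `S` is
    -- additive; comparing scalars then shows that `c` is multiplicative.
    have h4 : S (u + v) = S u + S v := by
      refine eq_of_weyl_eq_smul hd
        (c := (ZMod.stdAddChar (2⁻¹ * symplForm u v) * c (u + v))⁻¹ *
          (c v * c u * ZMod.stdAddChar (2⁻¹ * symplForm u v))) ?_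
      rw [mul_smul, eq_inv_smul_iff₀ (mul_ne_zero hx (hc0 _)), ← h1]
      congr 1
      ring
    rw [h4] at h1
    have h3 := smul_left_injective ℂ (weyl_ne_zero hd _) h1
    refine mul_right_cancel₀ hx ?_
    linear_combination -h3
  have hzero : c 0 = 1 := by
    have h := hadd 0 0
    rw [add_zero] at h
    exact mul_left_cancel₀ (hc0 0) (by rw [← h, mul_one])
  obtain ⟨a, ha⟩ := exists_symplForm_eq_addChar (d := d) (n := n)
    { toFun := c, map_zero_eq_one' := hzero, map_add_eq_mul' := hadd }
  refine ⟨S, a, hsym, fun u => ?_⟩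
  rw [hS, ← ha]
  rfl

theorem IsClifford.exists_perm (hd : Odd d) {U : Op d n} (hU : IsClifford U) :
    ∃ e : Equiv.Perm (PhaseSpace d n), ∀ w, U * phasePoint w * Uᴴ = phasePoint (e w) := by
  obtain ⟨S, a, hsym, hS⟩ := hU.exists_symplectic hd
  have hinj : Function.Injective S := fun u v h => eq_of_symplForm fun w => by
    rw [← hsym, h, hsym]
  let s : Equiv.Perm (PhaseSpace d n) := Equiv.ofBijective S (Finite.injective_iff_bijective.mp hinj)
  refine ⟨(Equiv.addRight a).trans s, fun w => ?_⟩
  rw [phasePoint_eq_sum hd, phasePoint_eq_sum hd, mul_smul_comm, smul_mul_assoc, Finset.mul_sum,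
    Finset.sum_mul]
  congr 1
  refine Fintype.sum_equiv s _ _ fun u => ?_
  rw [mul_smul_comm, smul_mul_assoc, hS, smul_smul, ← AddChar.map_add_eq_mul,
    ← symplForm_add_left, ← hsym]
  rfl

/-! ### The Wigner function as a linear map -/

theorem wigner_sum {ι : Type*} (s : Finset ι) (ρ : ι → Op d n) (u : PhaseSpace d n) :
    wigner (∑ x ∈ s, ρ x) u = ∑ x ∈ s, wigner (ρ x) u := by
  simp only [wigner, Finset.mul_sum, trace_sum]

theorem wigner_add (ρ σ : Op d n) (u : PhaseSpace d n) :
    wigner (ρ + σ) u = wigner ρ u + wigner σ u := by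
  simp only [wigner, mul_add, trace_add]

theorem wigner_smul (p : ℝ) (ρ : Op d n) (u : PhaseSpace d n) :
    wigner (p • ρ) u = p * wigner ρ u := by
  simp only [wigner, mul_smul_comm, trace_smul, Complex.real_smul]
  ring

theorem wigner_apply (ρ : Op d n) (u : PhaseSpace d n) :
    wigner ρ u = ((d : ℂ) ^ n)⁻¹ * ∑ i, ∑ j, phasePoint u i j * ρ j i := by
  rw [wigner, trace]
  simp only [diag_apply, mul_apply]

/-- The character sum forces `i = j`, and with `i + j = 2b` and `d` odd both equal `b`. This
marginal property ties the Wigner function to the computational basis. -/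
theorem sum_phasePoint₁_apply (hd : Odd d) (b : ZMod d) (i j : ZMod d) :
    ∑ a, phasePoint₁ d (a, b) i j = if i = b ∧ j = b then (d : ℂ) else 0 := by
  simp only [phasePoint₁]
  by_cases h : i + j = 2 * b
  · simp only [if_pos h]
    rw [sum_stdAddChar_mul]
    refine if_congr ⟨fun h' => ?_, fun h' => ?_⟩ rfl rfl
    · constructor
      · exact two_mul_cancel hd (by linear_combination h + h')
      · exact two_mul_cancel hd (by linear_combination h - h')
    · rw [h'.1, h'.2, sub_self]
  · simp only [if_neg h, Finset.sum_const_zero]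
    rw [if_neg]
    rintro ⟨rfl, rfl⟩
    exact h (by ring)

theorem sum_phasePoint (hd : Odd d) : ∑ u : PhaseSpace d n, phasePoint u = ((d : ℂ) ^ n) • 1 := by
  have h1 : ∑ a, phasePoint₁ d a = (d : ℂ) • 1 := by
    ext i j
    rw [Matrix.sum_apply, Fintype.sum_prod_type_right]
    simp only [sum_phasePoint₁_apply hd, Matrix.smul_apply, one_apply, smul_eq_mul, mul_ite,
      mul_one, mul_zero]
    by_cases h : i = j
    · subst h
      simp
    · rw [if_neg h]
      exact Finset.sum_eq_zero fun b _ => if_neg fun h' => h (h'.1.trans h'.2.symm)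
  simp only [phasePoint_eq_prodOp hd]
  rw [sum_prodOp, h1, prodOp_smul, ← weyl_zero, weyl_eq_prodOp]
  have h0 : weyl₁ d 0 = 1 := by
    ext i j
    rw [weyl₁_apply]
    simp [one_apply]
  simp [h0]

theorem sum_wigner (hd : Odd d) (ρ : Op d n) : ∑ u, wigner ρ u = ρ.trace := by
  have hd0 : (d : ℂ) ^ n ≠ 0 := pow_ne_zero _ (NeZero.ne _)
  simp only [wigner]
  rw [← Finset.mul_sum, ← trace_sum, ← Finset.sum_mul, sum_phasePoint hd, smul_mul_assoc, one_mul,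
    trace_smul, smul_eq_mul, inv_mul_cancel_left₀ hd0]

/-! ### The Wigner 1-norm -/

theorem wignerNorm_nonneg (ρ : Op d n) : 0 ≤ wignerNorm n ρ :=
  Finset.sum_nonneg fun _ _ => norm_nonneg _

theorem wignerNorm_smul (p : ℝ) (ρ : Op d n) :
    wignerNorm n (p • ρ) = |p| * wignerNorm n ρ := by
  simp [wignerNorm, wigner_smul, Finset.mul_sum]

theorem wignerNorm_add_le (ρ σ : Op d n) :
    wignerNorm n (ρ + σ) ≤ wignerNorm n ρ + wignerNorm n σ := by
  rw [wignerNorm, wignerNorm, wignerNorm, ← Finset.sum_add_distrib]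
  exact Finset.sum_le_sum fun u _ => by rw [wigner_add]; exact norm_add_le _ _

theorem wignerNorm_sum_le {ι : Type*} (s : Finset ι) (ρ : ι → Op d n) :
    wignerNorm n (∑ x ∈ s, ρ x) ≤ ∑ x ∈ s, wignerNorm n (ρ x) := by
  simp only [wignerNorm]
  rw [Finset.sum_comm]
  exact Finset.sum_le_sum fun u _ => by rw [wigner_sum]; exact norm_sum_le _ _

theorem wignerNorm_convex (ρ σ : Op d n) {p q : ℝ} (hp : 0 ≤ p) (hq : 0 ≤ q) :
    wignerNorm n (p • ρ + q • σ) ≤ p * wignerNorm n ρ + q * wignerNorm n σ := by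
  refine (wignerNorm_add_le _ _).trans_eq ?_
  rw [wignerNorm_smul, wignerNorm_smul, abs_of_nonneg hp, abs_of_nonneg hq]

theorem wignerNorm_clifford (hd : Odd d) {U : Op d n} (hU : IsClifford U) (ρ : Op d n) :
    wignerNorm n (U * ρ * Uᴴ) = wignerNorm n ρ := by
  obtain ⟨e, he⟩ := hU.exists_perm hd
  refine (Fintype.sum_equiv e _ _ fun u => ?_).symm
  rw [wigner, wigner, ← he, conj_mul_conj hU.1, trace_conj hU.1]

theorem norm_trace_le_wignerNorm (hd : Odd d) (ρ : Op d n) : ‖ρ.trace‖ ≤ wignerNorm n ρ := by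
  rw [← sum_wigner hd]
  exact norm_sum_le _ _

/-! ### Tensor products -/

theorem sum_append {m k : ℕ} {α : Type*} [Fintype α] (f : (Fin (m + k) → α) → ℂ) :
    ∑ x, f x = ∑ y : Fin m → α, ∑ z : Fin k → α, f (Fin.append y z) := by
  rw [← (Fin.appendEquiv m k).sum_comp, Fintype.sum_prod_type]
  rfl

theorem phasePoint_append (hd : Odd d) {k : ℕ} (u : PhaseSpace d n) (v : PhaseSpace d k)
    (i j : Fin n → ZMod d) (i' j' : Fin k → ZMod d) :
    phasePoint (Fin.append u v : PhaseSpace d (n + k)) (Fin.append i i') (Fin.append j j') =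
      phasePoint u i j * phasePoint v i' j' := by
  simp only [phasePoint_eq_prodOp hd, prodOp, Fin.prod_univ_add, Fin.append_left, Fin.append_right]

theorem wigner_tensor (hd : Odd d) {k : ℕ} (ρ : Op d n) (σ : Op d k) (u : PhaseSpace d n)
    (v : PhaseSpace d k) :
    wigner (tensor ρ σ) (Fin.append u v) = wigner ρ u * wigner σ v := by
  simp only [wigner_apply]
  rw [mul_mul_mul_comm, ← mul_inv, ← pow_add, sum_append]
  congr 1
  simp only [sum_append, phasePoint_append hd, tensor, Fin.append_left, Fin.append_right]
  rw [Finset.sum_mul_sum]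
  refine Finset.sum_congr rfl fun i _ => Finset.sum_congr rfl fun i' _ => ?_
  rw [Finset.sum_mul_sum]
  exact Finset.sum_congr rfl fun j _ => Finset.sum_congr rfl fun j' _ => mul_mul_mul_comm _ _ _ _

theorem wignerNorm_tensor (hd : Odd d) {k : ℕ} (ρ : Op d n) (σ : Op d k) :
    wignerNorm (n + k) (tensor ρ σ) = wignerNorm n ρ * wignerNorm k σ := by
  simp only [wignerNorm]
  rw [← (Fin.appendEquiv n k).sum_comp, Fintype.sum_prod_type, Finset.sum_mul_sum]
  refine Finset.sum_congr rfl fun u _ => Finset.sum_congr rfl fun v _ => ?_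
  rw [← norm_mul, ← wigner_tensor hd]
  rfl

theorem trace_tensor {k : ℕ} (ρ : Op d n) (σ : Op d k) :
    (tensor ρ σ).trace = ρ.trace * σ.trace := by
  simp only [trace, diag_apply]
  rw [sum_append, Finset.sum_mul_sum]
  simp only [tensor, Fin.append_left, Fin.append_right]

theorem posSemidef_tensor {k : ℕ} {ρ : Op d n} {σ : Op d k} (hρ : ρ.PosSemidef)
    (hσ : σ.PosSemidef) : (tensor ρ σ).PosSemidef :=
  (hρ.kronecker hσ).submatrix (Fin.appendEquiv n k).symm

/-! ### Stabilizer states -/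

/-- The Wigner function is `d^(-n)` where all second coordinates vanish and zero elsewhere. Being
nonnegative, its 1-norm is its sum, the trace. -/
theorem wignerNorm_single (hd : Odd d) : wignerNorm n (single 0 0 1 : Op d n) = 1 := by
  have hd0 : (d : ℂ) ^ n ≠ 0 := pow_ne_zero _ (NeZero.ne _)
  have h : ∀ u : PhaseSpace d n, wigner (single 0 0 1 : Op d n) u =
      ((d : ℂ) ^ n)⁻¹ * ∏ k, (if (u k).2 = 0 then 1 else 0) := by
    intro u
    rw [wigner, trace_mul_single]
    simp only [phasePoint_eq_prodOp hd, prodOp, phasePoint₁, Pi.zero_apply, add_zero, sub_zero,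
      mul_zero, AddChar.map_zero_eq_one, MulOpposite.op_one, one_smul]
    congr 1
    refine Finset.prod_congr rfl fun k _ => if_congr ⟨fun h => ?_, fun h => ?_⟩ rfl rfl
    · exact two_mul_cancel hd (by rw [← h, mul_zero])
    · rw [h, mul_zero]
  have h' : ∀ u : PhaseSpace d n, (‖wigner (single 0 0 1 : Op d n) u‖ : ℂ) =
      wigner (single 0 0 1 : Op d n) u := by
    intro u
    refine (Complex.eq_coe_norm_of_nonneg ?_).symm
    rw [h]
    exact mul_nonneg (by positivity) (Finset.prod_nonneg fun k _ => by split_ifs <;> simp)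
  have h1 : ((wignerNorm n (single 0 0 1 : Op d n) : ℝ) : ℂ) = 1 := by
    rw [wignerNorm, Complex.ofReal_sum]
    simp only [h']
    rw [sum_wigner hd, trace_single_eq_same]
  exact_mod_cast h1

theorem posSemidef_of_mem_stabilizerStates {σ : Op d n} (hσ : σ ∈ stabilizerStates d n) :
    σ.PosSemidef ∧ σ.trace = 1 := by
  refine convexHull_min (t := {σ : Op d n | σ.PosSemidef ∧ σ.trace = 1}) ?_ ?_ hσ
  · rintro _ ⟨U, hU, rfl⟩
    refine ⟨PosSemidef.mul_mul_conjTranspose_same ?_ U, ?_⟩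
    · rw [← diagonal_single]
      exact PosSemidef.diagonal (Pi.single_nonneg.mpr zero_le_one)
    · rw [trace_conj hU.1, trace_single_eq_same]
  · rintro ρ ⟨h1, h2⟩ σ ⟨h3, h4⟩ p q hp hq hpq
    refine ⟨(h1.smul hp).add (h3.smul hq), ?_⟩
    rw [trace_add, trace_smul, trace_smul, h2, h4, ← add_smul, hpq, one_smul]

/-- The set of operators of norm at most 1 is convex and contains the pure stabilizer states;
conversely the norm dominates the modulus of the trace. -/
theorem wignerNorm_of_mem_stabilizerStates (hd : Odd d) {σ : Op d n}
    (hσ : σ ∈ stabilizerStates d n) : wignerNorm n σ = 1 := by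
  refine le_antisymm ?_ ?_
  · refine convexHull_min (t := {σ : Op d n | wignerNorm n σ ≤ 1}) ?_ ?_ hσ
    · rintro _ ⟨U, hU, rfl⟩
      exact ((wignerNorm_clifford hd hU _).trans (wignerNorm_single hd)).le
    · intro ρ hρ σ hσ p q hp hq hpq
      refine (wignerNorm_convex ρ σ hp hq).trans ?_
      calc p * wignerNorm n ρ + q * wignerNorm n σ ≤ p * 1 + q * 1 :=
            add_le_add (mul_le_mul_of_nonneg_left hρ hp) (mul_le_mul_of_nonneg_left hσ hq)
        _ = 1 := by rw [mul_one, mul_one, hpq]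
  · refine le_trans ?_ (norm_trace_le_wignerNorm hd σ)
    rw [(posSemidef_of_mem_stabilizerStates hσ).2, norm_one]

/-! ### The final qudit -/

theorem sum_snoc {α M : Type*} [Fintype α] [AddCommMonoid M] (f : (Fin (n + 1) → α) → M) :
    ∑ x, f x = ∑ c : α, ∑ y : Fin n → α, f (Fin.snoc (α := fun _ => α) y c) := by
  rw [← (Fin.snocEquiv fun _ => α).sum_comp, Fintype.sum_prod_type]
  rfl

/-- The block `(𝟙 ⊗ ⟨y|) ρ (𝟙 ⊗ |z⟩)` of an operator with respect to the final qudit. -/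
def lastBlock (ρ : Op d (n + 1)) (y z : ZMod d) : Op d n :=
  fun i j => ρ (Fin.snoc (α := fun _ => ZMod d) i y) (Fin.snoc (α := fun _ => ZMod d) j z)

theorem partialTrace_eq_sum (ρ : Op d (n + 1)) : partialTrace ρ = ∑ c, lastBlock ρ c c := by
  ext i j
  rw [Matrix.sum_apply]
  rfl

/-- The factor of `A` on the final qudit splits off. The block indices are swapped because the trace
pairs entry `(y, z)` of `A` with entry `(z, y)` of `ρ`. -/
theorem wigner_snoc (hd : Odd d) (ρ : Op d (n + 1)) (u : PhaseSpace d n) (a : ZMod d × ZMod d) :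
    wigner ρ (Fin.snoc (α := fun _ => ZMod d × ZMod d) u a) =
      (d : ℂ)⁻¹ * ∑ y, ∑ z, phasePoint₁ d a y z * wigner (lastBlock ρ z y) u := by
  have h : ∀ (i j : Fin n → ZMod d) (y z : ZMod d),
      (phasePoint (Fin.snoc (α := fun _ => ZMod d × ZMod d) u a : PhaseSpace d (n + 1)))
        (Fin.snoc (α := fun _ => ZMod d) i y) (Fin.snoc (α := fun _ => ZMod d) j z) =
      phasePoint u i j * phasePoint₁ d a y z := by
    intro i j y z
    simp only [phasePoint_eq_prodOp hd, prodOp, Fin.prod_univ_castSucc, Fin.snoc_castSucc,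
      Fin.snoc_last]
  simp only [wigner_apply, sum_snoc, h, lastBlock]
  rw [pow_succ, _root_.mul_inv_rev, mul_assoc]
  congr 1
  simp only [mul_left_comm _ ((d : ℂ) ^ n)⁻¹ _, ← Finset.mul_sum]
  congr 1
  refine Finset.sum_congr rfl fun y _ => ?_
  rw [Finset.sum_comm]
  refine Finset.sum_congr rfl fun z _ => ?_
  simp only [Finset.mul_sum]
  exact Finset.sum_congr rfl fun i _ => Finset.sum_congr rfl fun j _ => by ring

theorem sum_wigner_snoc (hd : Odd d) (ρ : Op d (n + 1)) (u : PhaseSpace d n) (b : ZMod d) :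
    ∑ a, wigner ρ (Fin.snoc (α := fun _ => ZMod d × ZMod d) u (a, b)) =
      wigner (lastBlock ρ b b) u := by
  have hd0 : (d : ℂ) ≠ 0 := NeZero.ne _
  simp only [wigner_snoc hd]
  rw [← Finset.mul_sum, Finset.sum_comm, Finset.sum_eq_single b, Finset.sum_comm,
    Finset.sum_eq_single b]
  · rw [← Finset.sum_mul, sum_phasePoint₁_apply hd, if_pos ⟨rfl, rfl⟩, inv_mul_cancel_left₀ hd0]
  · intro z _ hz
    rw [← Finset.sum_mul, sum_phasePoint₁_apply hd, if_neg (fun h => hz h.2), zero_mul]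
  · simp
  · intro y _ hy
    rw [Finset.sum_comm]
    refine Finset.sum_eq_zero fun z _ => ?_
    rw [← Finset.sum_mul, sum_phasePoint₁_apply hd, if_neg (fun h => hy h.1), zero_mul]
  · simp

theorem wignerNorm_succ (ρ : Op d (n + 1)) :
    wignerNorm (n + 1) ρ = ∑ b, ∑ u : PhaseSpace d n, ∑ a,
      ‖wigner ρ (Fin.snoc (α := fun _ => ZMod d × ZMod d) u (a, b))‖ := by
  rw [wignerNorm, sum_snoc, Fintype.sum_prod_type_right]
  exact Finset.sum_congr rfl fun b _ => Finset.sum_comm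

theorem sum_wignerNorm_lastBlock_le (hd : Odd d) (ρ : Op d (n + 1)) :
    ∑ c, wignerNorm n (lastBlock ρ c c) ≤ wignerNorm (n + 1) ρ := by
  rw [wignerNorm_succ]
  refine Finset.sum_le_sum fun b _ => Finset.sum_le_sum fun u _ => ?_
  rw [← sum_wigner_snoc hd]
  exact norm_sum_le _ _

theorem wignerNorm_partialTrace_le (hd : Odd d) (ρ : Op d (n + 1)) :
    wignerNorm n (partialTrace ρ) ≤ wignerNorm (n + 1) ρ := by
  rw [partialTrace_eq_sum]
  exact (wignerNorm_sum_le _ _).trans (sum_wignerNorm_lastBlock_le hd ρ)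

theorem lastBlock_measure (ρ : Op d (n + 1)) (c y z : ZMod d) :
    lastBlock (lastProj n c * ρ * lastProj n c) y z =
      if y = c ∧ z = c then lastBlock ρ c c else 0 := by
  ext i j
  rw [lastBlock, lastProj, mul_diagonal, diagonal_mul, Fin.snoc_last, Fin.snoc_last]
  by_cases hy : y = c
  · by_cases hz : z = c
    · subst hy hz
      simp [lastBlock]
    · simp [hz]
  · simp [hy]

theorem wignerNorm_measure (hd : Odd d) (ρ : Op d (n + 1)) (c : ZMod d) :
    wignerNorm (n + 1) (lastProj n c * ρ * lastProj n c) = wignerNorm n (lastBlock ρ c c) := by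
  have hd0 : (d : ℝ) ≠ 0 := NeZero.ne _
  -- Only the block `(c, c)` survives, so the Wigner function lives on `b = c` and does not depend
  -- on `a`; the `d` values of `a` later cancel the factor `d⁻¹`.
  have h : ∀ (u : PhaseSpace d n) (a b : ZMod d),
      ‖wigner (lastProj n c * ρ * lastProj n c)
        (Fin.snoc (α := fun _ => ZMod d × ZMod d) u (a, b))‖ =
      if b = c then (d : ℝ)⁻¹ * ‖wigner (lastBlock ρ c c) u‖ else 0 := by
    intro u a b
    have h0 : wigner (0 : Op d n) u = 0 := by simp [wigner]
    rw [wigner_snoc hd, Finset.sum_eq_single c, Finset.sum_eq_single c]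
    · rw [lastBlock_measure, if_pos ⟨rfl, rfl⟩, phasePoint₁]
      by_cases hb : b = c
      · rw [if_pos hb, if_pos (by rw [hb]; ring)]
        simp
      · rw [if_neg hb, if_neg (fun h => hb (two_mul_cancel hd (by rw [← h]; ring)))]
        simp
    · intro z _ hz
      rw [lastBlock_measure, if_neg (fun h => hz h.1), h0, mul_zero]
    · simp
    · intro y _ hy
      refine Finset.sum_eq_zero fun z _ => ?_
      rw [lastBlock_measure, if_neg (fun h => hy h.2), h0, mul_zero]
    · simp
  rw [wignerNorm_succ, Finset.sum_eq_single c]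
  · simp only [h, if_true, Finset.sum_const, Finset.card_univ, ZMod.card, nsmul_eq_mul]
    exact Finset.sum_congr rfl fun u _ => mul_inv_cancel_left₀ hd0 _
  · intro b _ hb
    simp [h, hb]
  · simp

theorem sum_wignerNorm_measure_le (hd : Odd d) (ρ : Op d (n + 1)) :
    ∑ c, wignerNorm (n + 1) (lastProj n c * ρ * lastProj n c) ≤ wignerNorm (n + 1) ρ := by
  simp only [wignerNorm_measure hd]
  exact sum_wignerNorm_lastBlock_le hd ρ

theorem trace_measure (ρ : Op d (n + 1)) (c : ZMod d) :
    (lastProj n c * ρ * lastProj n c).trace = (ρ * lastProj n c).trace := by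
  rw [mul_assoc, trace_mul_comm, mul_assoc]
  congr 2
  rw [lastProj, diagonal_mul_diagonal]
  congr 1
  funext i
  split_ifs <;> simp

theorem sum_trace_measure (ρ : Op d (n + 1)) :
    ∑ c, (lastProj n c * ρ * lastProj n c).trace = ρ.trace := by
  have h : ∑ c : ZMod d, lastProj n c = 1 := by
    ext i j
    rw [Matrix.sum_apply]
    by_cases h : i = j
    · subst h
      simp [lastProj]
    · simp [lastProj, h]
  simp only [trace_measure]
  rw [← trace_sum, ← Finset.mul_sum, h, mul_one]

theorem posSemidef_measure {ρ : Op d (n + 1)} (hρ : ρ.PosSemidef) (c : ZMod d) :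
    (lastProj n c * ρ * lastProj n c).PosSemidef := by
  have h : (lastProj n c)ᴴ = lastProj n c := by
    rw [lastProj, diagonal_conjTranspose]
    congr 1
    funext i
    simp only [Pi.star_apply]
    split_ifs <;> simp
  have := hρ.mul_mul_conjTranspose_same (lastProj n c)
  rwa [h] at this

theorem trace_partialTrace (ρ : Op d (n + 1)) : (partialTrace ρ).trace = ρ.trace := by
  simp only [trace, diag_apply]
  rw [sum_snoc, Finset.sum_comm]
  rfl

theorem posSemidef_partialTrace {ρ : Op d (n + 1)} (hρ : ρ.PosSemidef) :
    (partialTrace ρ).PosSemidef := by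
  rw [partialTrace_eq_sum]
  exact posSemidef_sum _ fun c _ =>
    hρ.submatrix fun i : Fin n → ZMod d => Fin.snoc (α := fun _ => ZMod d) i c

/-! ### Stabilizer protocols -/

/-- Holding for all operators, not only states, the bound can be applied in the case `cond` to the
subnormalised intermediate outputs. -/
theorem IsStabilizerProtocol.sum_wignerNorm_le (hd : Odd d) {m : ℕ} {ι : Type} [Fintype ι]
    {Λ : Op d n → ι → Op d m} (hΛ : IsStabilizerProtocol d Λ) (ρ : Op d n) :
    ∑ x, wignerNorm m (Λ ρ x) ≤ wignerNorm n ρ := by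
  induction hΛ with
  | clifford U hU => simpa using (wignerNorm_clifford hd hU ρ).le
  | compose σ hσ =>
    simp [wignerNorm_tensor hd, wignerNorm_of_mem_stabilizerStates hd hσ]
  | measure => exact sum_wignerNorm_measure_le hd ρ
  | trace => simpa using wignerNorm_partialTrace_le hd ρ
  | random p hp hp1 =>
    simp only [wignerNorm_smul, abs_of_nonneg (hp _)]
    rw [← Finset.sum_mul, hp1, one_mul]
  | cond Λ Γ _ _ ihΛ ihΓ =>
    rw [Fintype.sum_prod_type]
    exact (Finset.sum_le_sum fun x _ => ihΓ x _).trans (ihΛ ρ)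
  | coarse Λ f _ ih =>
    refine (Finset.sum_le_sum fun y _ => wignerNorm_sum_le _ _).trans ?_
    rw [Finset.sum_fiberwise]
    exact ih ρ

theorem IsStabilizerProtocol.posSemidef {m : ℕ} {ι : Type} [Fintype ι]
    {Λ : Op d n → ι → Op d m} (hΛ : IsStabilizerProtocol d Λ) {ρ : Op d n} (hρ : ρ.PosSemidef)
    (x : ι) : (Λ ρ x).PosSemidef := by
  induction hΛ with
  | clifford U hU => exact hρ.mul_mul_conjTranspose_same U
  | compose σ hσ => exact posSemidef_tensor hρ (posSemidef_of_mem_stabilizerStates hσ).1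
  | measure => exact posSemidef_measure hρ x
  | trace => exact posSemidef_partialTrace hρ
  | random p hp hp1 => exact hρ.smul (hp x)
  | cond Λ Γ _ _ ihΛ ihΓ => exact ihΓ _ (ihΛ hρ _) _
  | coarse Λ f _ ih => exact posSemidef_sum _ fun y _ => ih hρ y

theorem IsStabilizerProtocol.sum_trace {m : ℕ} {ι : Type} [Fintype ι]
    {Λ : Op d n → ι → Op d m} (hΛ : IsStabilizerProtocol d Λ) (ρ : Op d n) :
    ∑ x, (Λ ρ x).trace = ρ.trace := by
  induction hΛ with
  | clifford U hU => simpa using trace_conj hU.1 ρ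
  | compose σ hσ => simp [trace_tensor, (posSemidef_of_mem_stabilizerStates hσ).2]
  | measure => exact sum_trace_measure ρ
  | trace => simpa using trace_partialTrace ρ
  | random p hp hp1 =>
    simp only [trace_smul]
    rw [← Finset.sum_smul, hp1, one_smul]
  | cond Λ Γ _ _ ihΛ ihΓ =>
    rw [Fintype.sum_prod_type, ← ihΛ ρ]
    exact Finset.sum_congr rfl fun x _ => ihΓ x (Λ ρ x)
  | coarse Λ f _ ih =>
    simp only [trace_sum]
    rw [Finset.sum_fiberwise]
    exact ih ρ

/-! ### Monotonicity -/

/-- An equality for `p > 0`; the left side is zero for `p = 0` and nonpositive for `p < 0`, so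
outcomes of probability zero need no separate treatment. -/
theorem mul_wignerNorm_inv_smul_le {p : ℝ} (ρ : Op d n) :
    p * wignerNorm n (p⁻¹ • ρ) ≤ wignerNorm n ρ := by
  rw [wignerNorm_smul, ← mul_assoc]
  refine mul_le_of_le_one_left (wignerNorm_nonneg ρ) ?_
  rcases eq_or_ne p 0 with rfl | hp
  · simp
  · calc p * |p⁻¹| ≤ |p| * |p⁻¹| := mul_le_mul_of_nonneg_right (le_abs_self p) (abs_nonneg _)
      _ = 1 := by rw [← abs_mul, mul_inv_cancel₀ hp, abs_one]

theorem isMagicMonotone_wignerNorm (hd : Odd d) : IsMagicMonotone d wignerNorm := by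
  intro n m ι _ Λ hΛ ρ _
  exact (Finset.sum_le_sum fun x _ => mul_wignerNorm_inv_smul_le _).trans
    (hΛ.sum_wignerNorm_le hd ρ)

theorem sum_measProb_mul_wignerNorm_le (hd : Odd d) (ρ : Op d (n + 1)) :
    ∑ c, measProb ρ c * wignerNorm (n + 1) (measState ρ c) ≤ wignerNorm (n + 1) ρ :=
  (Finset.sum_le_sum fun _ _ => mul_wignerNorm_inv_smul_le _).trans
    (sum_wignerNorm_measure_le hd ρ)

/-- The negative part of a real `t` is `(|t| - t)/2`, and the Wigner function sums to the trace. The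
trace is kept general for use on subnormalised outputs. -/
theorem sumNegativity_eq (hd : Odd d) {ρ : Op d n} (hρ : ρ.IsHermitian) :
    sumNegativity n ρ = 1 / 2 * (wignerNorm n ρ - ρ.trace.re) := by
  have h : ∀ u, ‖wigner ρ u‖ = |(wigner ρ u).re| := fun u =>
    (Complex.abs_re_eq_norm.mpr (wigner_im hd hρ u)).symm
  rw [sumNegativity, wignerNorm, ← sum_wigner hd, Complex.re_sum, ← Finset.sum_sub_distrib,
    Finset.mul_sum, Finset.sum_filter]
  refine Finset.sum_congr rfl fun u _ => ?_
  rw [h]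
  split_ifs with hu
  · rw [abs_of_neg hu]
    ring
  · rw [abs_of_nonneg (not_lt.mp hu)]
    ring

theorem sumNegativity_nonneg (ρ : Op d n) : 0 ≤ sumNegativity n ρ :=
  Finset.sum_nonneg fun _ _ => norm_nonneg _

theorem mul_sumNegativity_inv_smul_le (hd : Odd d) {p : ℝ} (hp : 0 ≤ p) {ρ : Op d n}
    (hρ : ρ.IsHermitian) : p * sumNegativity n (p⁻¹ • ρ) ≤ sumNegativity n ρ := by
  rcases hp.eq_or_lt with rfl | hp
  · rw [zero_mul]
    exact sumNegativity_nonneg ρ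
  · have hh : (p⁻¹ • ρ).IsHermitian := by
      rw [IsHermitian, conjTranspose_smul, hρ.eq, star_trivial]
    rw [sumNegativity_eq hd hρ, sumNegativity_eq hd hh, wignerNorm_smul, trace_smul,
      Complex.smul_re, smul_eq_mul, abs_of_pos (inv_pos.mpr hp)]
    apply le_of_eq
    field_simp

theorem isMagicMonotone_sumNegativity (hd : Odd d) : IsMagicMonotone d sumNegativity := by
  intro n m ι _ Λ hΛ ρ hρ
  have hpos := hΛ.posSemidef hρ.1
  refine (Finset.sum_le_sum fun x _ => mul_sumNegativity_inv_smul_le hd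
    (Complex.nonneg_iff.mp (hpos x).trace_nonneg).1 (hpos x).isHermitian).trans ?_
  -- The trace terms on the two sides agree, leaving only the bound on the 1-norms.
  have htr : ∑ x, (Λ ρ x).trace.re = ρ.trace.re := by
    rw [← Complex.re_sum, hΛ.sum_trace]
  simp only [sumNegativity_eq hd (hpos _).isHermitian]
  rw [sumNegativity_eq hd hρ.1.isHermitian, ← Finset.mul_sum, Finset.sum_sub_distrib, htr]
  have := hΛ.sum_wignerNorm_le hd ρ
  linarith

end

end Qudit

theorem mainTheorem3 (d : ℕ) [Fact d.Prime] (hd : d ≠ 2) :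
    -- the Wigner 1-norm is a magic monotone
    Qudit.IsMagicMonotone d Qudit.wignerNorm ∧
    -- it is convex on states
    (∀ (n : ℕ) (ρ σ : Qudit.Op d n) (p : ℝ), Qudit.IsState ρ → Qudit.IsState σ → 0 ≤ p → p ≤ 1 →
      Qudit.wignerNorm n (p • ρ + (1 - p) • σ) ≤
        p * Qudit.wignerNorm n ρ + (1 - p) * Qudit.wignerNorm n σ) ∧
    -- it is invariant under Clifford unitaries
    (∀ (n : ℕ) (ρ U : Qudit.Op d n), Qudit.IsState ρ → Qudit.IsClifford U →
      Qudit.wignerNorm n (U * ρ * U.conjTranspose) = Qudit.wignerNorm n ρ) ∧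
    -- it is invariant under composition with stabilizer states
    (∀ (n k : ℕ) (ρ : Qudit.Op d n) (σ : Qudit.Op d k), Qudit.IsState ρ →
      σ ∈ Qudit.stabilizerStates d k →
      Qudit.wignerNorm (n + k) (Qudit.tensor ρ σ) = Qudit.wignerNorm n ρ) ∧
    -- it does not increase under the partial trace over the final qudit
    (∀ (n : ℕ) (ρ : Qudit.Op d (n + 1)), Qudit.IsState ρ →
      Qudit.wignerNorm n (Qudit.partialTrace ρ) ≤ Qudit.wignerNorm (n + 1) ρ) ∧
    -- it does not increase on average under computational basis measurement of the final qudit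
    (∀ (n : ℕ) (ρ : Qudit.Op d (n + 1)), Qudit.IsState ρ →
      ∑ c : ZMod d, Qudit.measProb ρ c * Qudit.wignerNorm (n + 1) (Qudit.measState ρ c) ≤
        Qudit.wignerNorm (n + 1) ρ) ∧
    -- the sum negativity is a linear function of it, and is a magic monotone
    (∀ (n : ℕ) (ρ : Qudit.Op d n), Qudit.IsState ρ →
      Qudit.sumNegativity n ρ = 1 / 2 * (Qudit.wignerNorm n ρ - 1)) ∧
    Qudit.IsMagicMonotone d Qudit.sumNegativity := by
  have hodd : Odd d := (Fact.out : d.Prime).odd_of_ne_two hd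
  refine ⟨Qudit.isMagicMonotone_wignerNorm hodd, fun n ρ σ p _ _ hp hp1 =>
    Qudit.wignerNorm_convex ρ σ hp (sub_nonneg.mpr hp1), fun n ρ U _ hU =>
    Qudit.wignerNorm_clifford hodd hU ρ, fun n k ρ σ _ hσ => ?_, fun n ρ _ =>
    Qudit.wignerNorm_partialTrace_le hodd ρ, fun n ρ _ =>
    Qudit.sum_measProb_mul_wignerNorm_le hodd ρ, fun n ρ hρ => ?_,
    Qudit.isMagicMonotone_sumNegativity hodd⟩
  · rw [Qudit.wignerNorm_tensor hodd, Qudit.wignerNorm_of_mem_stabilizerStates hodd hσ, mul_one]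
  · rw [Qudit.sumNegativity_eq hodd hρ.1.isHermitian, hρ.2, Complex.one_re]
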